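/- Let $T$ be a complete first-order theory in a language $L$, and fix a monster model $\mathbb M\models T$: for some uncountable cardinal $\kappa>|L|$, $\mathbb M$ is $\kappa$-saturated and strongly $\kappa$-homogeneous (partial elementary maps between sets of size $<\kappa$ extend to automorphisms). ``Small'' means of cardinality $<\kappa$; all sets below are small subsets of $\mathbb M$; $\operatorname{acl}$ is the algebraic closure in $\mathbb M$; $\equiv_C$ means having the same type over $C$. $T$ is a \emph{free amalgamation theory} if there is a ternary relation $A\perp_C B$ on small subsets of $\mathbb M$ such that: \begin{itemize} \item (Invariance) whether $A\perp_C B$ holds depends only on the type of $ABC$; \item (Monotonicity) if $A\perp_C B$, $A_0\subseteq A$ and $B_0\subseteq B$, then $A_0\perp_C B_0$; \item (Full transitivity) if $D\subseteq C\subseteq B$, then $A\perp_D B$ if and only if $A\perp_D C$ and $A\perp_C B$; \item (Full existence) for all $A,B$ and all algebraically closed $C$ there is $A'\equiv_C A$ with $A'\perp_C B$; \item (Stationarity) for algebraically closed $A,B,C$ with $C\subseteq A\cap B$, if $A'\equiv_C A$, $A\perp_C B$ and $A'\perp_C B$, then $A'\equiv_B A$; \item (Freedom) if $A\perp_C B$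 and $C\cap(A\cup B)\subseteq D\subseteq C$, then $A\perp_D B$; \item (Closure) for algebraically closed $A,B,C$ with $C\subseteq A\cap B$ and $A\perp_C B$, the set $A\cup B$ is algebraically closed. \end{itemize} Let $M\prec\mathbb M$ be small. A complete type $p(y)$ over $\mathbb M$ is \emph{$M$-invariant} if, for each formula $\varphi(z,y)$ without parameters, whether $\varphi(c,y)\in p$ depends only on $\operatorname{tp}(c/M)$. A sequence $(b_i)_{i<\omega}$ is an \emph{invariant Morley sequence over $M$} if there is an $M$-invariant complete type $p$ over $\mathbb M$ with $b_i\models p|_{M\{b_j:j<i\}}$ for all $i$. For a formula $\varphi(x,c)$ with a finite parameter tuple $c$ from $\mathbb M$: it \emph{Conant-divides} over $M$ if for every invariant Morley sequence $(b_i)_{i<\omega}$ over $M$ with $b_0=c$ the set $\{\varphi(x,b_i):i<\omega\}$ is inconsistent; it \emph{Conant-forks} over $M$ if it implies a finite disjunction of formulas with parameters in $\mathbb M$, each of which Conant-divides over $M$. A set $A$ is \emph{Conant-independent} from $B$ over $M$ if $\operatorname{tp}(A/MB)$ contains no formula that Conant-forks over $M$. \textbf{Proposition.} Let $T$ be a free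 amalgamation theory. For every small model $M\prec\mathbb M$ and all small sets $A,B\subseteq\mathbb M$, $A$ is Conant-independent from $B$ over $M$ if and only if $\operatorname{acl}(A\cup M)\cap\operatorname{acl}(B\cup M)=M$. -/

import Mathlib

open FirstOrder FirstOrder.Language

universe u v w x y

namespace ConantIndep

section Types

variable (L : FirstOrder.Language.{u, v}) {𝕄 : Type w} [L.Structure 𝕄]

/-- The tuples `a` and `a'` have the same type over `C`, i.e. `a ≡_C a'`. -/
def SameTypeOver {ι : Type x} (C : Set 𝕄) (a a' : ι → 𝕄) : Prop :=
  ∀ φ : L[[C]].Formula ι, φ.Realize a ↔ φ.Realize a'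

/-- The (real) algebraic closure of `A`: the union of all finite `A`-definable sets. -/
def acl (A : Set 𝕄) : Set 𝕄 :=
  {e | ∃ S : Set 𝕄, A.Definable₁ L S ∧ S.Finite ∧ e ∈ S}

variable (𝕄) in
/-- `𝕄` is a monster model with respect to `κ`: `κ` is uncountable and greater than the
cardinality of the language, `𝕄` is `κ`-saturated and strongly `κ`-homogeneous. -/
structure IsMonster [Nonempty 𝕄] (κ : Cardinal.{w}) : Prop where
  aleph0_lt : Cardinal.aleph0 < κ
  card_lt : Cardinal.lift.{w} L.card < Cardinal.lift.{max u v} κ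
  saturated : ∀ C : Set 𝕄, Cardinal.mk C < κ →
    ∀ p : (L[[C]].completeTheory 𝕄).CompleteType (Fin 1),
      p ∈ (L[[C]].completeTheory 𝕄).realizedTypes 𝕄 (Fin 1)
  homogeneous : ∀ C : Set 𝕄, Cardinal.mk C < κ → ∀ f : C → 𝕄,
    SameTypeOver L (∅ : Set 𝕄) (fun c : C => (c : 𝕄)) f → ∃ σ : 𝕄 ≃[L] 𝕄, ∀ c : C, σ c = f c

end Types

section FreeAmalgamation

variable (L : FirstOrder.Language.{u, v}) {𝕄 : Type w} [L.Structure 𝕄]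

/-- The axioms of a free amalgamation relation on the small subsets of `𝕄`;
`R A C B` stands for "`A` is independent from `B` over `C`". The tuple enumerating a set `A` is
the inclusion `A → 𝕄`, and `f : A → 𝕄` with the same type over `C` is a tuple `a' ≡_C a`. -/
structure IsFreeAmalgamationRelation (κ : Cardinal.{w})
    (R : Set 𝕄 → Set 𝕄 → Set 𝕄 → Prop) : Prop where
  invariance : ∀ A B C : Set 𝕄, Cardinal.mk A < κ → Cardinal.mk B < κ → Cardinal.mk C < κ →
    ∀ f : 𝕄 → 𝕄,
      SameTypeOver L (∅ : Set 𝕄) (fun e : ↥(A ∪ B ∪ C) => (e : 𝕄))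
        (fun e : ↥(A ∪ B ∪ C) => f e) →
      (R A C B ↔ R (f '' A) (f '' C) (f '' B))
  monotonicity : ∀ A B C A₀ B₀ : Set 𝕄,
    Cardinal.mk A < κ → Cardinal.mk B < κ → Cardinal.mk C < κ →
    A₀ ⊆ A → B₀ ⊆ B → R A C B → R A₀ C B₀
  full_transitivity : ∀ A B C D : Set 𝕄, Cardinal.mk A < κ → Cardinal.mk B < κ →
    D ⊆ C → C ⊆ B → (R A D B ↔ R A D C ∧ R A C B)
  full_existence : ∀ A B C : Set 𝕄,
    Cardinal.mk A < κ → Cardinal.mk B < κ → Cardinal.mk C < κ → acl L C = C →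
    ∃ f : A → 𝕄, SameTypeOver L C (fun e : A => (e : 𝕄)) f ∧ R (Set.range f) C B
  stationarity : ∀ A B C : Set 𝕄, Cardinal.mk A < κ → Cardinal.mk B < κ →
    acl L A = A → acl L B = B → acl L C = C → C ⊆ A ∩ B →
    ∀ f : A → 𝕄, SameTypeOver L C (fun e : A => (e : 𝕄)) f →
      R A C B → R (Set.range f) C B → SameTypeOver L B (fun e : A => (e : 𝕄)) f
  freedom : ∀ A B C D : Set 𝕄,
    Cardinal.mk A < κ → Cardinal.mk B < κ → Cardinal.mk C < κ →
    R A C B → C ∩ (A ∪ B) ⊆ D → D ⊆ C → R A D B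
  closure : ∀ A B C : Set 𝕄, Cardinal.mk A < κ → Cardinal.mk B < κ →
    acl L A = A → acl L B = B → acl L C = C → C ⊆ A ∩ B → R A C B → acl L (A ∪ B) = A ∪ B

/-- `T` is a free amalgamation theory, as seen in its fixed monster model `𝕄`: it is complete,
and there is a free amalgamation relation on the subsets of `𝕄` of cardinality less than `κ`. -/
structure IsFreeAmalgamationTheory (T : L.Theory) (𝕄 : Type w) [L.Structure 𝕄] [Nonempty 𝕄]
    (κ : Cardinal.{w}) : Prop where
  complete : T.IsComplete
  model : 𝕄 ⊨ T
  monster : IsMonster L 𝕄 κ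
  exists_relation : ∃ R : Set 𝕄 → Set 𝕄 → Set 𝕄 → Prop, IsFreeAmalgamationRelation L κ R

end FreeAmalgamation

section ConantIndependence

variable {L : FirstOrder.Language.{u, v}} {𝕄 : Type w} [L.Structure 𝕄]

/-- The formula `φ(c, y)` with parameters `c` in `𝕄`. -/
def instantiate {γ : Type x} {β : Type y} (φ : L.Formula (γ ⊕ β)) (c : γ → 𝕄) :
    L[[𝕄]].Formula β :=
  BoundedFormula.constantsVarsEquiv.symm (φ.relabel (Sum.map c id) : L.Formula (𝕄 ⊕ β))

theorem realize_instantiate {γ : Type x} {β : Type y} (φ : L.Formula (γ ⊕ β)) (c : γ → 𝕄)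
    (a : β → 𝕄) : (instantiate φ c).Realize a ↔ φ.Realize (Sum.elim c a) := by
  unfold instantiate Formula.Realize
  rw [← BoundedFormula.realize_constantsVarsEquiv, Equiv.apply_symm_apply]
  change Formula.Realize _ _ ↔ Formula.Realize _ _
  rw [Formula.realize_relabel]
  have h : Sum.elim (fun a => ((L.con a : L[[𝕄]].Constants) : 𝕄)) a ∘ Sum.map c id
      = Sum.elim c a := by
    funext i
    rcases i with i | i
    · rfl
    · rfl
  rw [h]

variable (L 𝕄) in
/-- Global types: complete types over `𝕄` in variables indexed by `β`. -/
abbrev GlobalType (β : Type x) : Type _ := (L.elementaryDiagram 𝕄).CompleteType β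

/-- The formula `φ(c, y)` belongs to the global type `p(y)`. -/
def GlobalType.Has {β : Type x} (p : GlobalType L 𝕄 β) {k : ℕ}
    (φ : L.Formula (Fin k ⊕ β)) (c : Fin k → 𝕄) : Prop :=
  Formula.equivSentence (instantiate φ c) ∈ p

/-- The global type `p(y)` is invariant over `M`. -/
def GlobalType.IsInvariant {β : Type x} (p : GlobalType L 𝕄 β) (M : Set 𝕄) : Prop :=
  ∀ (k : ℕ) (φ : L.Formula (Fin k ⊕ β)) (c c' : Fin k → 𝕄),
    SameTypeOver L M c c' → (GlobalType.Has p φ c ↔ GlobalType.Has p φ c')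

/-- The tuple `b` realizes the restriction of the global type `p(y)` to `C`. -/
def GlobalType.RealizesOver {β : Type x} (p : GlobalType L 𝕄 β) (C : Set 𝕄) (b : β → 𝕄) :
    Prop :=
  ∀ (k : ℕ) (φ : L.Formula (Fin k ⊕ β)) (c : Fin k → 𝕄), (∀ j, c j ∈ C) →
    GlobalType.Has p φ c → φ.Realize (Sum.elim c b)

variable (L) in
/-- `b 0, b 1, …` is an invariant Morley sequence over `M`: for a fixed `M`-invariant global type
`p`, each `b i` realizes the restriction of `p` to `M` together with all `b j`, `j < i`. -/
def IsInvariantMorleySequence {β : Type x} (M : Set 𝕄) (b : ℕ → β → 𝕄) : Prop :=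
  ∃ p : GlobalType L 𝕄 β, GlobalType.IsInvariant p M ∧
    ∀ i : ℕ, GlobalType.RealizesOver p (M ∪ ⋃ j < i, Set.range (b j)) (b i)

/-- The formula `φ(x, c)` Conant-divides over `M`: for every invariant Morley sequence over `M`
starting with `c`, the set of formulas `φ(x, b i)`, `i < ω`, is inconsistent, that is, has a finite
subset with no realization. -/
def ConantDivides (M : Set 𝕄) {n m : ℕ} (φ : L.Formula (Fin n ⊕ Fin m)) (c : Fin m → 𝕄) : Prop :=
  ∀ b : ℕ → Fin m → 𝕄, IsInvariantMorleySequence L M b → b 0 = c →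
    ∃ s : Finset ℕ, ¬ ∃ a : Fin n → 𝕄, ∀ i ∈ s, φ.Realize (Sum.elim a (b i))

/-- The formula `φ(x, c)` Conant-forks over `M`: it implies a finite disjunction of formulas
(with parameters anywhere in `𝕄`) that Conant-divide over `M`. -/
def ConantForks (M : Set 𝕄) {n m : ℕ} (φ : L.Formula (Fin n ⊕ Fin m)) (c : Fin m → 𝕄) : Prop :=
  ∃ (N : ℕ) (k : Fin N → ℕ) (ψ : ∀ j, L.Formula (Fin n ⊕ Fin (k j))) (d : ∀ j, Fin (k j) → 𝕄),
    (∀ j, ConantDivides M (ψ j) (d j)) ∧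
    ∀ a : Fin n → 𝕄, φ.Realize (Sum.elim a c) → ∃ j, (ψ j).Realize (Sum.elim a (d j))

variable (L) in
/-- `A` is Conant-independent from `B` over `M`: the type of `A` over `M ∪ B` contains no formula
that Conant-forks over `M`. -/
def ConantIndependent (M A B : Set 𝕄) : Prop :=
  ∀ (n m : ℕ) (φ : L.Formula (Fin n ⊕ Fin m)) (a : Fin n → 𝕄) (c : Fin m → 𝕄),
    (∀ i, a i ∈ A) → (∀ j, c j ∈ M ∪ B) → φ.Realize (Sum.elim a c) → ¬ ConantForks M φ c

variable (L) in
/-- Algebraic independence over `M`. -/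
def AlgIndependent (M A B : Set 𝕄) : Prop :=
  acl L (A ∪ M) ∩ acl L (B ∪ M) = M

end ConantIndependence

end ConantIndep

namespace ConantIndep

/-! ### Types over small sets and automorphisms. -/

section Basics

variable {L : FirstOrder.Language.{u, v}} {𝕄 : Type w} [L.Structure 𝕄]

/-! Suppose `acl (A ∪ M)` and `acl (B ∪ M)` meet only in `M`, and a formula of the type of `A` over
`M ∪ B` implies a disjunction of formulas `ψ j (x, d j)`. Free independence implies algebraic
independence (`inter_subset`), so full existence moves `A` over `B ∪ M` until its closure also
avoids, outside `M`, the closure `D` of `B`, `M` and all `d j` (`exists_aut_algIndependent`). The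
moved tuple satisfies some `ψ j (x, d j)`. Now copy `D` repeatedly over the closure of the moved
`A`, each copy free from the earlier ones. Freedom lowers the base to `M`; closure keeps the union
of the copies algebraically closed; stationarity then makes the copies of `d j` follow one
`M`-invariant global type (`exists_invariant_globalType`, `exists_morleySequence`). The moved tuple
satisfies `ψ j` along this whole invariant Morley sequence, so `ψ j (x, d j)` does not
Conant-divide.

Conversely, let `e` outside `M` lie in both closures. Then `e` satisfies a formula `χ(a, m, y)` with
a bound on the number of solutions uniform in `a`, and also lies in a finite `B ∪ M`-definable set
disjoint from `M`. The formula saying that `χ(x, m, y)` has a solution in this set implies the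
disjunction of the `χ(x, m, f)` over its elements `f`. Each disjunct Conant-divides: along a Morley
sequence `m` stays constant while `f` takes distinct values (`injective_coord`,
`conantDivides_of_bounded`). This direction needs only the monster model. -/

theorem realize_constantsVarsEquiv_iff {ι : Type x} {C : Set 𝕄} (φ : L[[C]].Formula ι)
    (a : ι → 𝕄) :
    Formula.Realize (BoundedFormula.constantsVarsEquiv φ : L.Formula (C ⊕ ι))
      (Sum.elim (fun c : C => (c : 𝕄)) a) ↔ φ.Realize a :=
  BoundedFormula.realize_constantsVarsEquiv

theorem sameTypeOver_iff {ι : Type x} {C : Set 𝕄} {a a' : ι → 𝕄} :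
    SameTypeOver L C a a' ↔ ∀ φ : L.Formula (C ⊕ ι),
      φ.Realize (Sum.elim (fun c : C => (c : 𝕄)) a) ↔
        φ.Realize (Sum.elim (fun c : C => (c : 𝕄)) a') := by
  constructor
  · intro h φ
    have := h (BoundedFormula.constantsVarsEquiv.symm φ)
    rw [← realize_constantsVarsEquiv_iff, ← realize_constantsVarsEquiv_iff] at this
    simpa using this
  · intro h φ
    rw [← realize_constantsVarsEquiv_iff, ← realize_constantsVarsEquiv_iff]
    exact h _

theorem sameTypeOver_comp_aut {ι : Type x} {C : Set 𝕄} (σ : 𝕄 ≃[L] 𝕄) (hσ : ∀ c ∈ C, σ c = c)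
    (a : ι → 𝕄) : SameTypeOver L C a (σ ∘ a) := by
  rw [sameTypeOver_iff]
  intro φ
  rw [← StrongHomClass.realize_formula σ φ]
  have : σ ∘ Sum.elim (fun c : C => (c : 𝕄)) a = Sum.elim (fun c : C => (c : 𝕄)) (σ ∘ a) := by
    funext i
    rcases i with i | i
    · exact hσ _ i.2
    · rfl
  rw [this]

/-- Strong homogeneity speaks of maps on a set, whereas `a` may repeat entries or meet `C`; a
section `s` of the enumeration of `C ∪ range a` bridges the two. -/
theorem exists_aut_of_sameTypeOver [Nonempty 𝕄] {κ : Cardinal.{w}} (h𝕄 : IsMonster L 𝕄 κ)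
    {ι : Type x} {C : Set 𝕄} {a a' : ι → 𝕄} (hC : Cardinal.mk C < κ)
    (ha : Cardinal.mk (Set.range a) < κ) (h : SameTypeOver L C a a') :
    ∃ σ : 𝕄 ≃[L] 𝕄, (∀ c ∈ C, σ c = c) ∧ ∀ i, σ (a i) = a' i := by
  classical
  rw [sameTypeOver_iff] at h
  have hlt : Cardinal.mk ↥(C ∪ Set.range a) < κ :=
    (Cardinal.mk_union_le _ _).trans_lt (Cardinal.add_lt_of_lt h𝕄.aleph0_lt.le hC ha)
  let s : ↥(C ∪ Set.range a) → C ⊕ ι := fun e =>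
    if hc : (e : 𝕄) ∈ C then Sum.inl ⟨e, hc⟩
    else Sum.inr (e.2.resolve_left hc).choose
  have hs : ∀ e, Sum.elim (fun c : C => (c : 𝕄)) a (s e) = e := by
    intro e
    by_cases hc : (e : 𝕄) ∈ C
    · simp [s, hc]
    · simpa [s, hc] using (e.2.resolve_left hc).choose_spec
  obtain ⟨σ, hσ⟩ := h𝕄.homogeneous (C ∪ Set.range a) hlt
    (fun e => Sum.elim (fun c : C => (c : 𝕄)) a' (s e)) (by
      rw [sameTypeOver_iff]
      intro φ
      have := h (φ.relabel (Sum.elim (fun c : (∅ : Set 𝕄) => c.2.elim) s))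
      rw [Formula.realize_relabel, Formula.realize_relabel] at this
      convert this using 2
      · funext i
        rcases i with i | i
        · exact i.2.elim
        · exact (hs i).symm
      · funext i
        rcases i with i | i
        · exact i.2.elim
        · rfl)
  -- Equality is a formula, so `a'` repeats entries wherever `a` does and the choice of section is
  -- immaterial.
  have key : ∀ i j : C ⊕ ι, Sum.elim (fun c : C => (c : 𝕄)) a i
      = Sum.elim (fun c : C => (c : 𝕄)) a j →
      Sum.elim (fun c : C => (c : 𝕄)) a' i = Sum.elim (fun c : C => (c : 𝕄)) a' j := by
    intro i j hij
    have := h (Term.equal (Term.var i) (Term.var j))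
    simpa [Formula.realize_equal, hij] using this
  have hσ' : ∀ i : C ⊕ ι, σ (Sum.elim (fun c : C => (c : 𝕄)) a i)
      = Sum.elim (fun c : C => (c : 𝕄)) a' i := by
    intro i
    have hi : Sum.elim (fun c : C => (c : 𝕄)) a i ∈ C ∪ Set.range a := by
      rcases i with i | i
      · exact Or.inl i.2
      · exact Or.inr ⟨i, rfl⟩
    exact (hσ ⟨_, hi⟩).trans (key _ _ (hs ⟨_, hi⟩))
  exact ⟨σ, fun c hc => hσ' (Sum.inl ⟨c, hc⟩), fun i => hσ' (Sum.inr i)⟩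

end Basics

/-! ### Types as limits along ultrafilters, and saturation. -/

section UltrafilterTypes

/-- The limit of the types of tuples along an ultrafilter. -/
theorem exists_completeType_of_ultrafilter {L : FirstOrder.Language.{u, v}} (N : Type w)
    [L.Structure N] [Nonempty N] {β : Type x} (U : Ultrafilter (β → N)) :
    ∃ p : (L.completeTheory N).CompleteType β,
      ∀ φ : L.Formula β, Formula.equivSentence φ ∈ p ↔
        ∀ᶠ v : β → N in (U : Filter (β → N)), φ.Realize v := by
  let S : L[[β]].Theory := {s | ∀ᶠ v : β → N in (U : Filter (β → N)),
    (Formula.equivSentence.symm s).Realize v}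
  have hsat : ((L.lhomWithConstants β).onTheory (L.completeTheory N) ∪ S).IsSatisfiable := by
    rw [Theory.isSatisfiable_iff_isFinitelySatisfiable]
    intro T₀ hT₀
    have h : ∀ s ∈ T₀, ∀ᶠ v : β → N in (U : Filter (β → N)),
        (Formula.equivSentence.symm s).Realize v := by
      intro s hs
      rcases hT₀ hs with h | h
      · refine Filter.Eventually.of_forall fun v => ?_
        rw [Formula.realize_equivSentence_symm]
        let _ := constantsOn.structure v
        have : N ⊨ (L.lhomWithConstants β).onTheory (L.completeTheory N) :=
          (LHom.onTheory_model _ _).2 inferInstance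
        exact Theory.realize_sentence_of_mem
          ((L.lhomWithConstants β).onTheory (L.completeTheory N)) h
      · exact h
    obtain ⟨v, hv⟩ := ((Filter.eventually_all_finset T₀).2 h).exists
    let _ := constantsOn.structure v
    have : N ⊨ (T₀ : L[[β]].Theory) := by
      rw [Theory.model_iff]
      intro s hs
      exact (Formula.realize_equivSentence_symm N s v).1 (hv s hs)
    exact Theory.Model.isSatisfiable N
  obtain ⟨p, hp⟩ : {p : (L.completeTheory N).CompleteType β | S ⊆ ↑p}.Nonempty := by
    rw [Set.nonempty_iff_ne_empty, Ne, Theory.CompleteType.setOfPred_subset_eq_empty_iff]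
    exact not_not.2 hsat
  have hmem : ∀ φ : L.Formula β, (∀ᶠ v : β → N in (U : Filter (β → N)), φ.Realize v) →
      Formula.equivSentence φ ∈ p := by
    intro φ hφ
    refine hp ?_
    change ∀ᶠ v : β → N in (U : Filter (β → N)),
      (Formula.equivSentence.symm (Formula.equivSentence φ)).Realize v
    simpa using hφ
  refine ⟨p, fun φ => ⟨fun h => ?_, hmem φ⟩⟩
  by_contra hc
  rw [← Ultrafilter.eventually_not] at hc
  have h2 : (Formula.equivSentence φ).not ∈ p := hmem φ.not (by simpa using hc)
  exact (p.not_mem_iff _).1 h2 h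

variable {L : FirstOrder.Language.{u, v}} {𝕄 : Type w} [L.Structure 𝕄]

/-- Saturation in its usable form: the limit type of an ultrafilter, restricted to a small set, is
realized. -/
theorem IsMonster.exists_mem_iff_ultrafilter [Nonempty 𝕄] {κ : Cardinal.{w}}
    (h𝕄 : IsMonster L 𝕄 κ) {C : Set 𝕄} (hC : Cardinal.mk C < κ) (U : Ultrafilter 𝕄) :
    ∃ e : 𝕄, ∀ S : Set 𝕄, C.Definable₁ L S → (e ∈ S ↔ S ∈ U) := by
  obtain ⟨p, hp⟩ := exists_completeType_of_ultrafilter (L := L[[C]]) 𝕄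
    (U.map fun e => (fun _ : Fin 1 => e))
  obtain ⟨v, rfl⟩ := h𝕄.saturated C hC p
  refine ⟨v 0, fun S hS => ?_⟩
  obtain ⟨φ, hφ⟩ := hS
  have hφ' : ∀ w : Fin 1 → 𝕄, φ.Realize w ↔ w 0 ∈ S := fun w => by
    have := Set.ext_iff.1 hφ w
    exact this.symm
  rw [← hφ' v, ← Theory.CompleteType.formula_mem_typeOf (T := L[[C]].completeTheory 𝕄), hp]
  simp only [hφ']
  rfl

end UltrafilterTypes

/-! ### Algebraic closure: orbits, idempotence and cardinality. -/

section AlgebraicClosure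

variable {L : FirstOrder.Language.{u, v}} {𝕄 : Type w} [L.Structure 𝕄]

theorem definable₁_singleton_of_mem {C : Set 𝕄} {c : 𝕄} (hc : c ∈ C) :
    C.Definable₁ L {c} := by
  refine Set.definable_iff_exists_formula_sum.2
    ⟨Term.equal (Term.var (Sum.inl ⟨c, hc⟩)) (Term.var (Sum.inr 0)), ?_⟩
  ext w
  simp [Formula.realize_equal, eq_comm]

theorem definable₁_of_finite {C X : Set 𝕄} (hX : X.Finite) (hXC : X ⊆ C) : C.Definable₁ L X := by
  induction X, hX using Set.Finite.induction_on with
  | empty => exact Set.definable_empty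
  | insert _ _ ih =>
    exact (definable₁_singleton_of_mem (hXC (Set.mem_insert _ _))).union
      (ih ((Set.subset_insert _ _).trans hXC))

theorem Definable₁.aut_mem_iff {C S : Set 𝕄} (hS : C.Definable₁ L S) {σ : 𝕄 ≃[L] 𝕄}
    (hσ : ∀ c ∈ C, σ c = c) (e : 𝕄) : σ e ∈ S ↔ e ∈ S := by
  obtain ⟨φ, hφ⟩ := hS
  have h : ∀ w : Fin 1 → 𝕄, φ.Realize w ↔ w 0 ∈ S := fun w => (Set.ext_iff.1 hφ w).symm
  exact ((h fun _ => σ e).symm.trans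
    (sameTypeOver_comp_aut σ hσ (fun _ : Fin 1 => e) φ).symm).trans (h fun _ => e)

theorem subset_acl (C : Set 𝕄) : C ⊆ acl L C := fun c hc =>
  ⟨{c}, definable₁_singleton_of_mem hc, Set.finite_singleton c, rfl⟩

theorem acl_mono {C D : Set 𝕄} (h : C ⊆ D) : acl L C ⊆ acl L D := by
  rintro e ⟨S, hS, hf, he⟩
  exact ⟨S, Set.Definable.mono hS h, hf, he⟩

/-- A finite `M`-definable set stays `M`-definable after its points in `M` are removed; by the
Tarski–Vaught criterion the remainder is empty. -/
theorem acl_elementarySubstructure (M : L.ElementarySubstructure 𝕄) :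
    acl L (M : Set 𝕄) = M := by
  refine Set.Subset.antisymm ?_ (subset_acl _)
  rintro e ⟨S, hS, hf, he⟩
  by_contra heM
  have hd : (M : Set 𝕄).Definable₁ L (S \ (S ∩ M)) :=
    Set.Definable.sdiff hS
      (definable₁_of_finite (L := L) (hf.subset Set.inter_subset_left) Set.inter_subset_right)
  have hne : (S \ (S ∩ M)).Nonempty := ⟨e, he, fun h => heM h.2⟩
  obtain ⟨x, hx, hxM⟩ := M.meetsDefinable _ hne hd
  exact hx.2 ⟨hx.1, hxM⟩

theorem finite_orbit_of_mem_acl {C : Set 𝕄} {e : 𝕄} (he : e ∈ acl L C) :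
    {e' | ∃ σ : 𝕄 ≃[L] 𝕄, (∀ c ∈ C, σ c = c) ∧ σ e = e'}.Finite := by
  obtain ⟨S, hS, hf, he⟩ := he
  refine hf.subset ?_
  rintro _ ⟨σ, hσ, rfl⟩
  exact (Definable₁.aut_mem_iff hS hσ e).2 he

theorem exists_finset_of_mem_acl {C : Set 𝕄} {e : 𝕄} (he : e ∈ acl L C) :
    ∃ F : Finset 𝕄, (F : Set 𝕄) ⊆ C ∧ e ∈ acl L (F : Set 𝕄) := by
  obtain ⟨S, hS, hf, he⟩ := he
  obtain ⟨F, hF, hd⟩ := Set.definable_iff_finitely_definable.1 hS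
  exact ⟨F, hF, S, hd, hf, he⟩

variable [Nonempty 𝕄] {κ : Cardinal.{w}}

theorem IsMonster.mk_union_lt (h𝕄 : IsMonster L 𝕄 κ) {A B : Set 𝕄} (hA : Cardinal.mk A < κ)
    (hB : Cardinal.mk B < κ) : Cardinal.mk ↥(A ∪ B) < κ :=
  (Cardinal.mk_union_le _ _).trans_lt (Cardinal.add_lt_of_lt h𝕄.aleph0_lt.le hA hB)

theorem IsMonster.mk_lt_of_countable (h𝕄 : IsMonster L 𝕄 κ) {X : Set 𝕄} (hX : X.Countable) :
    Cardinal.mk X < κ :=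
  (Cardinal.le_aleph0_iff_set_countable.2 hX).trans_lt h𝕄.aleph0_lt

/-- If all conjugates of `e` over the small set `C` lie in a finite set, then `e` is algebraic
over `C`. -/
theorem IsMonster.mem_acl_of_orbit_subset (h𝕄 : IsMonster L 𝕄 κ) {C : Set 𝕄}
    (hC : Cardinal.mk C < κ) {X : Set 𝕄} (hX : X.Finite) {e : 𝕄}
    (h : ∀ σ : 𝕄 ≃[L] 𝕄, (∀ c ∈ C, σ c = c) → σ e ∈ X) : e ∈ acl L C := by
  by_contra hcon
  let I := {S : Set 𝕄 // C.Definable₁ L S ∧ e ∈ S}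
  have hI : Nonempty I := ⟨⟨Set.univ, Set.definable_univ, trivial⟩⟩
  have hne : (⨅ S : I, Filter.principal (S.1 \ X)).NeBot := by
    refine Filter.iInf_neBot_of_directed' ?_ ?_
    · rintro ⟨S, hS, heS⟩ ⟨S', hS', heS'⟩
      refine ⟨⟨S ∩ S', Set.Definable.inter hS hS', heS, heS'⟩, ?_, ?_⟩
      · exact Filter.principal_mono.2 (Set.sdiff_subset_sdiff_left Set.inter_subset_left)
      · exact Filter.principal_mono.2 (Set.sdiff_subset_sdiff_left Set.inter_subset_right)
    · rintro ⟨S, hS, heS⟩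
      rw [Filter.principal_neBot_iff]
      by_contra hemp
      refine hcon ⟨S, hS, hX.subset ?_, heS⟩
      rwa [Set.not_nonempty_iff_eq_empty, Set.sdiff_eq_empty] at hemp
  have hU : ∀ S : I, S.1 \ X ∈ Ultrafilter.of (⨅ S : I, Filter.principal (S.1 \ X)) := fun S =>
    Ultrafilter.of_le _ (Filter.mem_iInf_of_mem S (Filter.mem_principal_self _))
  -- The realization is taken over `C ∪ X`, not just `C`, so that the complement of `X` is among the
  -- definable sets tested. It yields a conjugate of `e` over `C` outside `X`.
  have hCX := h𝕄.mk_union_lt hC (h𝕄.mk_lt_of_countable hX.countable)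
  obtain ⟨e', he'⟩ := h𝕄.exists_mem_iff_ultrafilter hCX
    (Ultrafilter.of (⨅ S : I, Filter.principal (S.1 \ X)))
  have heX : e' ∉ X := by
    have : e' ∈ Xᶜ := (he' Xᶜ (Set.Definable.compl (definable₁_of_finite (L := L) hX
      Set.subset_union_right))).2 (Filter.mem_of_superset (hU hI.some) fun x hx => hx.2)
    exact this
  have hmem : ∀ S, C.Definable₁ L S → e ∈ S → e' ∈ S := fun S hS heS =>
    (he' S (Set.Definable.mono hS Set.subset_union_left)).2
      (Filter.mem_of_superset (hU ⟨S, hS, heS⟩) fun x hx => hx.1)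
  have htp : SameTypeOver L C (fun _ : Fin 1 => e) (fun _ : Fin 1 => e') := by
    intro φ
    have hd : C.Definable₁ L {z | φ.Realize fun _ : Fin 1 => z} := by
      refine ⟨φ, ?_⟩
      ext w
      have : (fun _ : Fin 1 => w 0) = w := funext fun i => by rw [Subsingleton.elim i 0]
      simp [this]
    refine ⟨fun hφ => hmem _ hd hφ, fun hφ => ?_⟩
    by_contra hn
    exact hmem {z | φ.Realize fun _ : Fin 1 => z}ᶜ (Set.Definable.compl hd) hn hφ
  obtain ⟨σ, hσ, hσe⟩ := exists_aut_of_sameTypeOver h𝕄 hC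
    (h𝕄.mk_lt_of_countable (Set.countable_range _)) htp
  exact heX (hσe 0 ▸ h σ hσ)

theorem IsMonster.mem_acl_iff (h𝕄 : IsMonster L 𝕄 κ) {C : Set 𝕄}
    (hC : Cardinal.mk C < κ) {e : 𝕄} : e ∈ acl L C ↔
    {e' | ∃ σ : 𝕄 ≃[L] 𝕄, (∀ c ∈ C, σ c = c) ∧ σ e = e'}.Finite :=
  ⟨finite_orbit_of_mem_acl, fun h => h𝕄.mem_acl_of_orbit_subset hC h fun σ hσ => ⟨σ, hσ, rfl⟩⟩

/-- Orbit counting: automorphisms over `C` have finitely many restrictions to a finite `F ⊆ acl C`,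
and those sharing the restriction of `τ` send `e` into the `τ`-image of its finite orbit over `F`.
-/
theorem IsMonster.acl_acl (h𝕄 : IsMonster L 𝕄 κ) {C : Set 𝕄} (hC : Cardinal.mk C < κ) :
    acl L (acl L C) = acl L C := by
  refine Set.Subset.antisymm (fun e he => ?_) (subset_acl _)
  obtain ⟨F, hF, he⟩ := exists_finset_of_mem_acl he
  have horb := finite_orbit_of_mem_acl he
  let G := {σ : 𝕄 ≃[L] 𝕄 // ∀ c ∈ C, σ c = c}
  have hfin : (Set.range fun (σ : G) (d : F) => σ.1 d).Finite := by
    refine (Set.Finite.pi' fun d : F => finite_orbit_of_mem_acl (hF d.2)).subset ?_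
    rintro _ ⟨σ, rfl⟩ d
    exact ⟨σ.1, σ.2, rfl⟩
  rw [h𝕄.mem_acl_iff hC]
  have hsub : (⋃ t ∈ Set.range fun (σ : G) (d : F) => σ.1 d,
      {e' | ∃ σ : G, (∀ d : F, σ.1 d = t d) ∧ σ.1 e = e'}).Finite := by
    refine hfin.biUnion ?_
    rintro _ ⟨τ, rfl⟩
    refine (horb.image τ.1).subset ?_
    rintro _ ⟨σ, hσ, rfl⟩
    refine ⟨τ.1.symm (σ.1 e), ⟨τ.1.symm.comp σ.1, fun c hc => ?_, rfl⟩, by simp⟩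
    have := hσ ⟨c, hc⟩
    simp only at this
    simp [this]
  refine hsub.subset ?_
  rintro _ ⟨σ, hσ, rfl⟩
  exact Set.mem_biUnion ⟨⟨σ, hσ⟩, rfl⟩ ⟨⟨σ, hσ⟩, fun _ => rfl, rfl⟩

theorem IsMonster.image_acl_subset (h𝕄 : IsMonster L 𝕄 κ) {C : Set 𝕄} (hC : Cardinal.mk C < κ)
    (σ : 𝕄 ≃[L] 𝕄) : σ '' acl L C ⊆ acl L (σ '' C) := by
  rintro _ ⟨e, he, rfl⟩
  rw [h𝕄.mem_acl_iff (Cardinal.mk_image_le.trans_lt hC)]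
  refine ((finite_orbit_of_mem_acl he).image σ).subset ?_
  rintro _ ⟨τ, hτ, rfl⟩
  refine ⟨σ.symm (τ (σ e)), ⟨σ.symm.comp (τ.comp σ), fun c hc => ?_, rfl⟩, by simp⟩
  simp [hτ _ (Set.mem_image_of_mem σ hc)]

theorem IsMonster.image_acl (h𝕄 : IsMonster L 𝕄 κ) {C : Set 𝕄} (hC : Cardinal.mk C < κ)
    (σ : 𝕄 ≃[L] 𝕄) : σ '' acl L C = acl L (σ '' C) := by
  refine Set.Subset.antisymm (h𝕄.image_acl_subset hC σ) fun e he => ?_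
  refine ⟨σ.symm e, ?_, by simp⟩
  have := h𝕄.image_acl_subset (Cardinal.mk_image_le.trans_lt hC) σ.symm
    (Set.mem_image_of_mem σ.symm he)
  rw [Set.image_image] at this
  simpa using this

/-- The closure is a union of finite sets indexed by formulas over `C`, of which there are fewer
than `κ`. -/
theorem IsMonster.mk_acl_lt (h𝕄 : IsMonster L 𝕄 κ) {C : Set 𝕄} (hC : Cardinal.mk C < κ) :
    Cardinal.mk (acl L C) < κ := by
  let F := {φ : L[[C]].Formula (Fin 1) // {z : 𝕄 | φ.Realize fun _ => z}.Finite}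
  have hsub : acl L C ⊆ ⋃ φ : F, {z : 𝕄 | φ.1.Realize fun _ => z} := by
    rintro e ⟨S, ⟨φ, hφ⟩, hf, he⟩
    have h : {z : 𝕄 | φ.Realize fun _ => z} = S := by
      ext z
      exact (Set.ext_iff.1 hφ (fun _ => z)).symm
    exact Set.mem_iUnion.2 ⟨⟨φ, h ▸ hf⟩, by rw [h]; exact he⟩
  have hF : Cardinal.lift.{w} (Cardinal.mk F) < Cardinal.lift.{max u v w} κ := by
    have h1 : Cardinal.mk F ≤ Cardinal.mk (Σ n, L[[C]].BoundedFormula (Fin 1) n) :=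
      (Cardinal.mk_subtype_le _).trans
        (Cardinal.mk_le_of_injective (f := fun φ => (⟨0, φ⟩ : Σ n, L[[C]].BoundedFormula (Fin 1) n))
          fun φ ψ h => by simpa using h)
    have h2 := h1.trans BoundedFormula.card_le
    rw [card_withConstants] at h2
    refine (Cardinal.lift_le.{w}.2 h2).trans_lt ?_
    have h3 := h𝕄.card_lt
    have h4 := h𝕄.aleph0_lt
    simp only [Cardinal.lift_max, Cardinal.lift_add, Cardinal.lift_lift, Cardinal.mk_fin]
    have h5 : Cardinal.lift.{max u v w, w} κ = Cardinal.lift.{max u v, w} κ :=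
      congrFun Cardinal.lift_umax.{w, max u v} κ
    have hκ : Cardinal.aleph0 < Cardinal.lift.{max u v, w} κ := Cardinal.aleph0_lt_lift.2 h4
    rw [h5, Cardinal.lift_umax.{w, max u v}]
    refine max_lt (by simpa using h4) (Cardinal.add_lt_of_lt hκ.le ?_
      (Cardinal.add_lt_of_lt hκ.le h3 (Cardinal.lift_lt.2 hC)))
    exact lt_of_le_of_lt (by simp) hκ
  have h1 : Cardinal.lift.{max u v w} (Cardinal.mk (acl L C)) ≤
      Cardinal.lift.{w} (Cardinal.mk F) * Cardinal.aleph0 := by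
    refine (Cardinal.lift_le.2 (Cardinal.mk_le_mk_of_subset hsub)).trans
      ((Cardinal.mk_iUnion_le_lift _).trans (mul_le_mul_right ?_ _))
    refine ciSup_le' fun φ => ?_
    rw [Cardinal.lift_le_aleph0]
    exact Cardinal.le_aleph0_iff_set_countable.2 φ.2.countable
  refine Cardinal.lift_lt.{w, max u v w}.1 (h1.trans_lt ?_)
  refine Cardinal.mul_lt_of_lt ?_ hF ?_
  · exact Cardinal.aleph0_le_lift.2 h𝕄.aleph0_lt.le
  · exact Cardinal.aleph0_lt_lift.2 h𝕄.aleph0_lt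

end AlgebraicClosure

/-! ### Free independence, invariant types, and algebraic independence implying Conant-independence.
-/

section FreeAmalgamation

variable {L : FirstOrder.Language.{u, v}} {𝕄 : Type w} [L.Structure 𝕄]

theorem image_eq_self_of_fixes {C : Set 𝕄} {σ : 𝕄 ≃[L] 𝕄} (hσ : ∀ c ∈ C, σ c = c) :
    σ '' C = C := by
  ext x
  constructor
  · rintro ⟨c, hc, rfl⟩
    rwa [hσ c hc]
  · exact fun hx => ⟨x, hx, hσ x hx⟩

theorem symm_fixes {C : Set 𝕄} {σ : 𝕄 ≃[L] 𝕄} (hσ : ∀ c ∈ C, σ c = c) :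
    ∀ c ∈ C, σ.symm c = c := fun c hc => by
  conv_lhs => rw [← hσ c hc]
  simp

theorem realize_elim_aut {γ : Type x} {β : Type y} (σ : 𝕄 ≃[L] 𝕄) (φ : L.Formula (γ ⊕ β))
    (c : γ → 𝕄) (b : β → 𝕄) :
    φ.Realize (Sum.elim (fun i => σ (c i)) fun j => σ (b j)) ↔ φ.Realize (Sum.elim c b) := by
  rw [← StrongHomClass.realize_formula σ φ (v := Sum.elim c b)]
  have : σ ∘ Sum.elim c b = Sum.elim (fun i => σ (c i)) fun j => σ (b j) := by
    funext i
    rcases i with i | i <;> rfl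
  rw [this]

theorem GlobalType.RealizesOver.mono {β : Type x} {p : GlobalType L 𝕄 β} {C D : Set 𝕄}
    {b : β → 𝕄} (h : GlobalType.RealizesOver p D b) (hCD : C ⊆ D) :
    GlobalType.RealizesOver p C b :=
  fun k φ c hc => h k φ c fun j => hCD (hc j)

variable {κ : Cardinal.{w}} {R : Set 𝕄 → Set 𝕄 → Set 𝕄 → Prop}

namespace IsFreeAmalgamationRelation

theorem image_iff (hR : IsFreeAmalgamationRelation L κ R) {A B C : Set 𝕄}
    (hA : Cardinal.mk A < κ) (hB : Cardinal.mk B < κ) (hC : Cardinal.mk C < κ)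
    (σ : 𝕄 ≃[L] 𝕄) : R A C B ↔ R (σ '' A) (σ '' C) (σ '' B) :=
  hR.invariance A B C hA hB hC σ (sameTypeOver_comp_aut σ (fun _ hc => hc.elim) _)

variable [Nonempty 𝕄]

theorem exists_aut (hR : IsFreeAmalgamationRelation L κ R) (h𝕄 : IsMonster L 𝕄 κ)
    {A B C : Set 𝕄} (hA : Cardinal.mk A < κ) (hB : Cardinal.mk B < κ)
    (hC : Cardinal.mk C < κ) (hCc : acl L C = C) :
    ∃ σ : 𝕄 ≃[L] 𝕄, (∀ c ∈ C, σ c = c) ∧ R (σ '' A) C B := by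
  obtain ⟨f, hf, hRf⟩ := hR.full_existence A B C hA hB hC hCc
  obtain ⟨σ, hσ, hσf⟩ := exists_aut_of_sameTypeOver h𝕄 hC (by rwa [Subtype.range_coe]) hf
  refine ⟨σ, hσ, ?_⟩
  have : f = fun e : A => σ e := funext fun e => (hσf e).symm
  rwa [Set.image_eq_range, ← this]

theorem stationarity_aut (hR : IsFreeAmalgamationRelation L κ R) (h𝕄 : IsMonster L 𝕄 κ)
    {A B C : Set 𝕄} (hA : Cardinal.mk A < κ) (hB : Cardinal.mk B < κ)
    (hAc : acl L A = A) (hBc : acl L B = B) (hCc : acl L C = C) (hCA : C ⊆ A) (hCB : C ⊆ B)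
    {σ : 𝕄 ≃[L] 𝕄} (hσ : ∀ c ∈ C, σ c = c) (h : R A C B) (h' : R (σ '' A) C B) :
    ∃ ρ : 𝕄 ≃[L] 𝕄, (∀ c ∈ B, ρ c = c) ∧ ∀ a ∈ A, ρ a = σ a := by
  rw [Set.image_eq_range] at h'
  obtain ⟨ρ, hρ, hρσ⟩ := exists_aut_of_sameTypeOver h𝕄 hB (by rwa [Subtype.range_coe])
    (hR.stationarity A B C hA hB hAc hBc hCc (Set.subset_inter hCA hCB) (fun e : A => σ e)
      (sameTypeOver_comp_aut σ hσ _) h h')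
  exact ⟨ρ, hρ, fun a ha => hρσ ⟨a, ha⟩⟩

/-- Free independence of algebraically closed sets implies algebraic independence. -/
theorem inter_subset (hR : IsFreeAmalgamationRelation L κ R) (h𝕄 : IsMonster L 𝕄 κ)
    {A B C : Set 𝕄} (hA : Cardinal.mk A < κ) (hB : Cardinal.mk B < κ)
    (hAc : acl L A = A) (hBc : acl L B = B) (hCc : acl L C = C) (hCA : C ⊆ A) (hCB : C ⊆ B)
    (h : R A C B) : A ∩ B ⊆ C := by
  rintro e ⟨heA, heB⟩
  have hC : Cardinal.mk C < κ := (Cardinal.mk_le_mk_of_subset hCA).trans_lt hA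
  have hCe : Cardinal.mk ↥(C ∪ {e}) < κ :=
    h𝕄.mk_union_lt hC (h𝕄.mk_lt_of_countable (Set.countable_singleton e))
  let D := acl L (C ∪ {e})
  have hD : Cardinal.mk D < κ := h𝕄.mk_acl_lt hCe
  have hDc : acl L D = D := h𝕄.acl_acl hCe
  have hCD : C ⊆ D := Set.subset_union_left.trans (subset_acl _)
  have heD : e ∈ D := subset_acl _ (Or.inr rfl)
  have hDA : D ⊆ A := (acl_mono (Set.union_subset hCA (Set.singleton_subset_iff.2 heA))).trans
    hAc.subset
  have hDB : D ⊆ B := (acl_mono (Set.union_subset hCB (Set.singleton_subset_iff.2 heB))).trans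
    hBc.subset
  have hDD : R D C D := hR.monotonicity A B C D D hA hB hC hDA hDB h
  rw [← hCc]
  refine h𝕄.mem_acl_of_orbit_subset hC (Set.finite_singleton e) fun σ hσ => ?_
  have hσD : Cardinal.mk (σ '' D) < κ := Cardinal.mk_image_le.trans_lt hD
  -- Take a copy of `D` free from both `D` and `σ '' D`. As `D` is free from itself, stationarity
  -- over `D` forces `τ` to fix `D` pointwise, whence `D` is free from `σ '' D`.
  obtain ⟨τ, hτ, hRτ⟩ := hR.exists_aut h𝕄 hD (h𝕄.mk_union_lt hD hσD) hC hCc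
  have hτD : Cardinal.mk (τ '' D) < κ := Cardinal.mk_image_le.trans_lt hD
  obtain ⟨ρ, hρ, hρτ⟩ := hR.stationarity_aut h𝕄 hD hD hDc hDc hCc hCD hCD hτ hDD
    (hR.monotonicity _ _ _ _ _ hτD (h𝕄.mk_union_lt hD hσD) hC subset_rfl
      Set.subset_union_left hRτ)
  have hτD' : τ '' D = D := image_eq_self_of_fixes fun d hd => by rw [← hρτ d hd, hρ d hd]
  have h1 : R D C (σ '' D) := by
    have := hR.monotonicity _ _ _ _ _ hτD (h𝕄.mk_union_lt hD hσD) hC subset_rfl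
      Set.subset_union_right hRτ
    rwa [hτD'] at this
  have h2 : R (σ '' D) C (σ '' D) := by
    have := (hR.image_iff hD hD hC σ).1 hDD
    rwa [image_eq_self_of_fixes hσ] at this
  have hCσ : C ⊆ σ '' D := by
    rw [← image_eq_self_of_fixes hσ]
    exact Set.image_mono hCD
  have hσDc : acl L (σ '' D) = σ '' D := by rw [← h𝕄.image_acl hD, hDc]
  -- Both `σ '' D` and `D` are now free from `σ '' D`, so stationarity makes `σ.symm` the identity
  -- on `σ '' D`.
  obtain ⟨ρ', hρ', hρσ⟩ := hR.stationarity_aut h𝕄 hσD hσD hσDc hσDc hCc hCσ hCσ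
    (symm_fixes hσ) h2 (by
      rw [Set.image_image]
      simpa using h1)
  have hσe : σ e ∈ σ '' D := Set.mem_image_of_mem _ heD
  have := hρσ _ hσe
  rw [hρ' _ hσe] at this
  simpa using this

/-- Extension for algebraic independence. -/
theorem exists_aut_algIndependent (hR : IsFreeAmalgamationRelation L κ R)
    (h𝕄 : IsMonster L 𝕄 κ) {M A B C : Set 𝕄} (hM : Cardinal.mk M < κ) (hA : Cardinal.mk A < κ)
    (hB : Cardinal.mk B < κ) (hC : Cardinal.mk C < κ) (hBC : B ⊆ C)
    (h : acl L (A ∪ M) ∩ acl L (B ∪ M) ⊆ M) :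
    ∃ σ : 𝕄 ≃[L] 𝕄, (∀ c ∈ B ∪ M, σ c = c) ∧ acl L (σ '' A ∪ M) ∩ acl L (C ∪ M) ⊆ M := by
  have hAM := h𝕄.mk_union_lt hA hM
  have hBM := h𝕄.mk_union_lt hB hM
  have hCM := h𝕄.mk_union_lt hC hM
  have hE := h𝕄.mk_acl_lt hBM
  have hAE := h𝕄.mk_union_lt hA hE
  have hEc := h𝕄.acl_acl hBM
  have hX := h𝕄.mk_acl_lt hAE
  obtain ⟨σ, hσ, hRσ⟩ := hR.exists_aut h𝕄 hX (h𝕄.mk_acl_lt hCM) hE hEc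
  have hσM : ∀ c ∈ M, σ c = c := fun c hc => hσ c (subset_acl _ (Or.inr hc))
  refine ⟨σ, fun c hc => hσ c (subset_acl _ hc), ?_⟩
  have hsub := hR.inter_subset h𝕄 (Cardinal.mk_image_le.trans_lt hX) (h𝕄.mk_acl_lt hCM)
    (by rw [← h𝕄.image_acl hX, h𝕄.acl_acl hAE]) (h𝕄.acl_acl hCM) hEc
    ((image_eq_self_of_fixes hσ).superset.trans
      (Set.image_mono (Set.subset_union_right.trans (subset_acl _))))
    (acl_mono (Set.union_subset_union_left _ hBC)) hRσ
  have heq : σ '' A ∪ M = σ '' (A ∪ M) := by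
    rw [Set.image_union, image_eq_self_of_fixes hσM]
  rw [heq, ← h𝕄.image_acl hAM]
  rintro _ ⟨⟨e, he, rfl⟩, heC⟩
  have heE : σ e ∈ acl L (B ∪ M) := by
    refine hsub ⟨Set.mem_image_of_mem _ (acl_mono ?_ he), heC⟩
    exact Set.union_subset_union_right _ (Set.subset_union_right.trans (subset_acl _))
  -- Since `σ` fixes `acl (B ∪ M)` pointwise and `σ e` lies there, `e` itself was already in both
  -- original closures.
  have hee : σ e = e := by
    apply σ.injective
    exact hσ _ heE
  rw [hee] at heE ⊢
  exact h ⟨he, heE⟩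

/-- The global `M`-invariant type of a tuple freely independent from everything over `M`. -/
theorem exists_invariant_globalType (hR : IsFreeAmalgamationRelation L κ R)
    (h𝕄 : IsMonster L 𝕄 κ) {M D : Set 𝕄} (hD : Cardinal.mk D < κ) (hMc : acl L M = M)
    (hDc : acl L D = D) (hMD : M ⊆ D) {β : Type x} (b : β → 𝕄) (hb : ∀ j, b j ∈ D) :
    ∃ p : GlobalType L 𝕄 β, GlobalType.IsInvariant p M ∧
      ∀ (σ : 𝕄 ≃[L] 𝕄) (C : Set 𝕄), (∀ c ∈ M, σ c = c) → Cardinal.mk C < κ → acl L C = C →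
        M ⊆ C → R (σ '' D) M C → GlobalType.RealizesOver p C (σ ∘ b) := by
  have hM : Cardinal.mk M < κ := (Cardinal.mk_le_mk_of_subset hMD).trans_lt hD
  -- `G C` holds the copies of `b` coming from copies of `D` free from `C` over `M`. These sets are
  -- nonempty by full existence and directed by monotonicity; `p` is a limit along them.
  let G : {C : Set 𝕄 // Cardinal.mk C < κ} → Set (β → 𝕄) := fun C =>
    {b' | ∃ σ : 𝕄 ≃[L] 𝕄, (∀ c ∈ M, σ c = c) ∧ R (σ '' D) M C ∧ b' = σ ∘ b}
  have : Nonempty {C : Set 𝕄 // Cardinal.mk C < κ} := ⟨⟨M, hM⟩⟩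
  have hne : (⨅ C, Filter.principal (G C)).NeBot := by
    refine Filter.iInf_neBot_of_directed' ?_ ?_
    · rintro ⟨C, hC⟩ ⟨C', hC'⟩
      refine ⟨⟨C ∪ C', h𝕄.mk_union_lt hC hC'⟩, Filter.principal_mono.2 ?_,
        Filter.principal_mono.2 ?_⟩
      · rintro _ ⟨σ, hσ, hRσ, rfl⟩
        exact ⟨σ, hσ, hR.monotonicity _ _ _ _ _ (Cardinal.mk_image_le.trans_lt hD)
          (h𝕄.mk_union_lt hC hC') hM subset_rfl Set.subset_union_left hRσ, rfl⟩
      · rintro _ ⟨σ, hσ, hRσ, rfl⟩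
        exact ⟨σ, hσ, hR.monotonicity _ _ _ _ _ (Cardinal.mk_image_le.trans_lt hD)
          (h𝕄.mk_union_lt hC hC') hM subset_rfl Set.subset_union_right hRσ, rfl⟩
    · rintro ⟨C, hC⟩
      obtain ⟨σ, hσ, hRσ⟩ := hR.exists_aut h𝕄 hD hC hM hMc
      exact Filter.principal_neBot_iff.2 ⟨_, σ, hσ, hRσ, rfl⟩
  obtain ⟨p, hp⟩ := exists_completeType_of_ultrafilter (L := L[[𝕄]]) 𝕄
    (Ultrafilter.of (⨅ C, Filter.principal (G C)))
  have key : ∀ (σ : 𝕄 ≃[L] 𝕄) (C : Set 𝕄), (∀ c ∈ M, σ c = c) → Cardinal.mk C < κ →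
      acl L C = C → M ⊆ C → R (σ '' D) M C → ∀ (k : ℕ) (φ : L.Formula (Fin k ⊕ β))
      (c : Fin k → 𝕄), (∀ j, c j ∈ C) →
      (GlobalType.Has p φ c ↔ φ.Realize (Sum.elim c (σ ∘ b))) := by
    intro σ C hσ hC hCc hMC hRσ k φ c hc
    have hmem : G ⟨C, hC⟩ ∈ Ultrafilter.of (⨅ C, Filter.principal (G C)) :=
      Ultrafilter.of_le _ (Filter.mem_iInf_of_mem ⟨C, hC⟩ (Filter.mem_principal_self _))
    -- By stationarity all members of `G C` have the same type over the closed set `C`, so any one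
    -- of them decides `p` there.
    have hiff : ∀ b' ∈ G ⟨C, hC⟩,
        (φ.Realize (Sum.elim c b') ↔ φ.Realize (Sum.elim c (σ ∘ b))) := by
      rintro _ ⟨σ', hσ', hRσ', rfl⟩
      have hMσ : M ⊆ σ '' D := by
        rw [← image_eq_self_of_fixes hσ]
        exact Set.image_mono hMD
      obtain ⟨ρ, hρ, hρσ⟩ := hR.stationarity_aut h𝕄 (Cardinal.mk_image_le.trans_lt hD) hC
        (by rw [← h𝕄.image_acl hD, hDc]) hCc hMc hMσ hMC (σ := σ'.comp σ.symm)
        (fun m hm => by simp [symm_fixes hσ m hm, hσ' m hm]) hRσ (by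
          rw [Set.image_image]
          simpa using hRσ')
      have h1 : (fun j => ρ (c j)) = c := funext fun j => hρ _ (hc j)
      have h2 : (fun j => ρ ((σ ∘ b) j)) = σ' ∘ b := funext fun j => by
        rw [Function.comp_apply, hρσ _ (Set.mem_image_of_mem _ (hb j))]
        simp
      rw [← realize_elim_aut ρ φ c (σ ∘ b), h1, h2]
    refine (hp _).trans ?_
    simp only [realize_instantiate]
    constructor
    · intro h
      obtain ⟨b', hb', hG⟩ := (h.and hmem).exists
      exact (hiff b' hG).1 hb'
    · intro h
      exact Filter.mem_of_superset hmem fun b' hb' => (hiff b' hb').2 h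
  refine ⟨p, ?_, fun σ C hσ hC hCc hMC hRσ k φ c hc => (key σ C hσ hC hCc hMC hRσ k φ c hc).1⟩
  intro k φ c c' hcc'
  have hcs : Cardinal.mk (Set.range c) < κ := h𝕄.mk_lt_of_countable (Set.countable_range _)
  obtain ⟨τ, hτ, hτc⟩ := exists_aut_of_sameTypeOver h𝕄 hM hcs hcc'
  have hMcs := h𝕄.mk_union_lt hM hcs
  have hC := h𝕄.mk_acl_lt hMcs
  have hCc := h𝕄.acl_acl hMcs
  have hMC : M ⊆ acl L (M ∪ Set.range c) := Set.subset_union_left.trans (subset_acl _)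
  obtain ⟨σ, hσ, hRσ⟩ := hR.exists_aut h𝕄 hD hC hM hMc
  have hσD : Cardinal.mk (σ '' D) < κ := Cardinal.mk_image_le.trans_lt hD
  have hcC : ∀ j, c j ∈ acl L (M ∪ Set.range c) := fun j => subset_acl _ (Or.inr ⟨j, rfl⟩)
  rw [key σ _ hσ hC hCc hMC hRσ k φ c hcC,
    key (τ.comp σ) (τ '' acl L (M ∪ Set.range c)) (fun m hm => by simp [hσ m hm, hτ m hm])
      (Cardinal.mk_image_le.trans_lt hC) (by rw [← h𝕄.image_acl hC, hCc])
      ((image_eq_self_of_fixes hτ).superset.trans (Set.image_mono hMC))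
      (by
        have := (hR.image_iff hσD hC hM τ).1 hRσ
        rw [image_eq_self_of_fixes hτ, Set.image_image] at this
        exact this)
      k φ c' (fun j => ⟨c j, hcC j, hτc j⟩),
    ← realize_elim_aut τ φ c (σ ∘ b)]
  have : (fun i => τ (c i)) = c' := funext hτc
  rw [this]
  rfl

/-- If `A` and `D` are algebraically closed and meet in `M`, then every tuple in `D` starts an
invariant Morley sequence over `M` whose terms all have the same type over `A`. -/
theorem exists_morleySequence (hR : IsFreeAmalgamationRelation L κ R)
    (h𝕄 : IsMonster L 𝕄 κ) {M A D : Set 𝕄} (hA : Cardinal.mk A < κ) (hD : Cardinal.mk D < κ)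
    (hMc : acl L M = M) (hAc : acl L A = A) (hDc : acl L D = D) (hMA : M ⊆ A) (hMD : M ⊆ D)
    (hAD : A ∩ D ⊆ M) {β : Type x} (b : β → 𝕄) (hb : ∀ j, b j ∈ D) :
    ∃ s : ℕ → β → 𝕄, IsInvariantMorleySequence L M s ∧ s 0 = b ∧
      ∀ i, ∃ τ : 𝕄 ≃[L] 𝕄, (∀ a ∈ A, τ a = a) ∧ s i = τ ∘ b := by
  have hM : Cardinal.mk M < κ := (Cardinal.mk_le_mk_of_subset hMD).trans_lt hD
  -- The last clause lets the first copy be `D` itself, giving `s 0 = b`; for `E = M ⊆ A` the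
  -- identity is legitimate because `τ.symm` fixes both `A` and `M`.
  have hstep : ∀ E : {E : Set 𝕄 // Cardinal.mk E < κ}, ∃ τ : 𝕄 ≃[L] 𝕄,
      (∀ a ∈ A, τ a = a) ∧ R (τ '' D) A E ∧ (E.1 = M → ∀ e, τ e = e) := by
    rintro ⟨E, hE⟩
    obtain ⟨τ, hτ, hRτ⟩ := hR.exists_aut h𝕄 hD hE hA hAc
    by_cases hEM : E = M
    · subst hEM
      refine ⟨FirstOrder.Language.Equiv.refl L 𝕄, fun _ _ => rfl, ?_, fun _ _ => rfl⟩
      have := (hR.image_iff (Cardinal.mk_image_le.trans_lt hD) hE hA τ.symm).1 hRτ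
      rw [image_eq_self_of_fixes (symm_fixes hτ),
        image_eq_self_of_fixes (fun e he => symm_fixes hτ e (hMA he)), Set.image_image] at this
      simpa using this
    · exact ⟨τ, hτ, hRτ, fun h => absurd h hEM⟩
  choose t htA htR htM using hstep
  let E : ℕ → {E : Set 𝕄 // Cardinal.mk E < κ} := fun n =>
    Nat.rec ⟨M, hM⟩ (fun _ F => ⟨F.1 ∪ t F '' D,
      h𝕄.mk_union_lt F.2 (Cardinal.mk_image_le.trans_lt hD)⟩) n
  have hE : ∀ n, (E (n + 1)).1 = (E n).1 ∪ t (E n) '' D := fun n => rfl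
  have hmono : Monotone fun n => (E n).1 :=
    monotone_nat_of_le_succ fun n => (hE n).symm ▸ Set.subset_union_left
  have hME : ∀ n, M ⊆ (E n).1 := fun n => hmono (Nat.zero_le n)
  have htD : ∀ F, A ∩ t F '' D ⊆ M := by
    rintro F _ ⟨hx, d, hd, rfl⟩
    have : t F d = d := (t F).injective (htA F _ hx)
    rw [this] at hx ⊢
    exact hAD ⟨hx, hd⟩
  have hAE : ∀ n, A ∩ (E n).1 ⊆ M := by
    intro n
    induction n with
    | zero => exact Set.inter_subset_right
    | succ n ih =>
      rw [hE, Set.inter_union_distrib_left]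
      exact Set.union_subset ih (htD _)
  -- Freedom applies because neither the new copy nor the earlier ones meet `A` outside `M`.
  have hREM : ∀ n, R (t (E n) '' D) M (E n).1 := fun n =>
    hR.freedom _ _ _ M (Cardinal.mk_image_le.trans_lt hD) (E n).2 hA (htR (E n))
      (by
        rw [Set.inter_union_distrib_left]
        exact Set.union_subset (htD _) (hAE n)) hMA
  have htMfix : ∀ F, ∀ m ∈ M, t F m = m := fun F m hm => htA F m (hMA hm)
  have hEc : ∀ n, acl L (E n).1 = (E n).1 := by
    intro n
    induction n with
    | zero => exact hMc
    | succ n ih =>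
      rw [hE, Set.union_comm]
      refine hR.closure _ _ M (Cardinal.mk_image_le.trans_lt hD) (E n).2
        (by rw [← h𝕄.image_acl hD, hDc]) ih hMc (Set.subset_inter ?_ (hME n)) (hREM n)
      rw [← image_eq_self_of_fixes (htMfix (E n))]
      exact Set.image_mono hMD
  obtain ⟨p, hpinv, hp⟩ := hR.exists_invariant_globalType h𝕄 hD hMc hDc hMD b hb
  refine ⟨fun i => t (E i) ∘ b, ⟨p, hpinv, fun i => ?_⟩, ?_, fun i => ⟨_, htA _, rfl⟩⟩
  · refine (hp (t (E i)) _ (htMfix _) (E i).2 (hEc i) (hME i) (hREM i)).mono ?_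
    refine Set.union_subset (hME i) (Set.iUnion₂_subset fun j hj => ?_)
    refine Set.Subset.trans ?_ (hmono (Nat.succ_le_of_lt hj))
    rintro _ ⟨k, rfl⟩
    exact Or.inr ⟨b k, hb k, rfl⟩
  · funext j
    exact htM (E 0) rfl _

/-- All parameters `d j` are absorbed into `B` before choosing which disjunct holds, so one move of
`A` serves whichever `j` arises. -/
theorem conantIndependent_of_inter_subset (hR : IsFreeAmalgamationRelation L κ R)
    (h𝕄 : IsMonster L 𝕄 κ) {M A B : Set 𝕄} (hM : Cardinal.mk M < κ) (hMc : acl L M = M)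
    (hA : Cardinal.mk A < κ) (hB : Cardinal.mk B < κ)
    (h : acl L (A ∪ M) ∩ acl L (B ∪ M) ⊆ M) : ConantIndependent L M A B := by
  rintro n m φ a c ha hc hφ ⟨N, k, ψ, d, hdiv, himp⟩
  have hd : Cardinal.mk ↥(⋃ j, Set.range (d j)) < κ :=
    h𝕄.mk_lt_of_countable (Set.countable_iUnion fun j => Set.countable_range _)
  have hBd := h𝕄.mk_union_lt hB hd
  obtain ⟨σ, hσ, hind⟩ :=
    hR.exists_aut_algIndependent h𝕄 hM hA hB hBd Set.subset_union_left h
  obtain ⟨j, hj⟩ := himp (fun i => σ (a i)) (by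
    have : c = fun i => σ (c i) := funext fun i => (hσ _ (hc i).symm).symm
    rw [this]
    exact (realize_elim_aut σ φ a c).2 hφ)
  have hσA : Cardinal.mk (σ '' A) < κ := Cardinal.mk_image_le.trans_lt hA
  have hAM := h𝕄.mk_union_lt hσA hM
  have hDM := h𝕄.mk_union_lt hBd hM
  obtain ⟨s, hs, hs0, hsA⟩ := hR.exists_morleySequence h𝕄 (h𝕄.mk_acl_lt hAM)
    (h𝕄.mk_acl_lt hDM) hMc (h𝕄.acl_acl hAM) (h𝕄.acl_acl hDM)
    (Set.subset_union_right.trans (subset_acl _)) (Set.subset_union_right.trans (subset_acl _))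
    hind (d j) fun i => subset_acl _ (Or.inl (Or.inr (Set.mem_iUnion.2 ⟨j, i, rfl⟩)))
  obtain ⟨F, hF⟩ := hdiv j s hs hs0
  refine hF ⟨fun i => σ (a i), fun i _ => ?_⟩
  obtain ⟨τ, hτ, hτs⟩ := hsA i
  have h1 : (fun i => σ (a i)) = fun i => τ (σ (a i)) :=
    funext fun i => (hτ _ (subset_acl _ (Or.inl ⟨a i, ha i, rfl⟩))).symm
  rw [hτs, h1]
  exact (realize_elim_aut τ (ψ j) _ _).2 hj

end IsFreeAmalgamationRelation

end FreeAmalgamation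

/-! ### Conant-independence implies algebraic independence. -/

section ConantDividing

variable {L : FirstOrder.Language.{u, v}} {𝕄 : Type w} [L.Structure 𝕄]

/-- The formula expressing that a parameter equals the `l`-th variable. -/
def eqCoordFormula {β : Type x} (l : β) : L.Formula (Fin 1 ⊕ β) :=
  Term.equal (Term.var (Sum.inl 0)) (Term.var (Sum.inr l))

theorem realize_eqCoordFormula {β : Type x} (l : β) (c : Fin 1 → 𝕄) (b : β → 𝕄) :
    (eqCoordFormula l : L.Formula (Fin 1 ⊕ β)).Realize (Sum.elim c b) ↔ c 0 = b l := by
  simp [eqCoordFormula, Formula.realize_equal]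

theorem GlobalType.has_not_iff {β : Type x} (p : GlobalType L 𝕄 β) {k : ℕ}
    (φ : L.Formula (Fin k ⊕ β)) (c : Fin k → 𝕄) :
    GlobalType.Has p φ.not c ↔ ¬ GlobalType.Has p φ c :=
  p.not_mem_iff (Formula.equivSentence (instantiate φ c))

/-- The type itself may be realized only in an elementary extension, but an existential statement
about it descends to `𝕄`. -/
theorem GlobalType.exists_realize {β : Type x} [Finite β] (p : GlobalType L 𝕄 β) {k m : ℕ}
    {φ : L.Formula (Fin k ⊕ β)} {c : Fin k → 𝕄} {ψ : L.Formula (Fin m ⊕ β)} {d : Fin m → 𝕄}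
    (hφ : GlobalType.Has p φ c) (hψ : GlobalType.Has p ψ d) :
    ∃ a : β → 𝕄, φ.Realize (Sum.elim c a) ∧ ψ.Realize (Sum.elim d a) := by
  obtain ⟨N, v, rfl⟩ := Theory.exists_modelType_is_realized_in _ p
  have hφ' := Theory.CompleteType.formula_mem_typeOf.1 hφ
  have hψ' := Theory.CompleteType.formula_mem_typeOf.1 hψ
  let χ : L[[𝕄]].Sentence :=
    Formula.iExs β ((instantiate φ c ⊓ instantiate ψ d).relabel (Sum.inr : β → Empty ⊕ β))
  have hχ : N ⊨ χ := by
    refine Formula.realize_iExs.2 ⟨v, ?_⟩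
    rw [Formula.realize_relabel]
    exact Formula.realize_inf.2 ⟨hφ', hψ'⟩
  have hχ' : 𝕄 ⊨ χ := (realize_iff_of_model_completeTheory 𝕄 N χ).1 hχ
  obtain ⟨a, ha⟩ := Formula.realize_iExs.1 hχ'
  rw [Formula.realize_relabel] at ha
  have ha' := Formula.realize_inf.1 ha
  exact ⟨a, (realize_instantiate φ c a).1 ha'.1, (realize_instantiate ψ d a).1 ha'.2⟩

theorem GlobalType.RealizesOver.has_iff {β : Type x} {p : GlobalType L 𝕄 β} {C : Set 𝕄}
    {b : β → 𝕄} (h : GlobalType.RealizesOver p C b) {k : ℕ} (φ : L.Formula (Fin k ⊕ β))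
    {c : Fin k → 𝕄} (hc : ∀ j, c j ∈ C) :
    GlobalType.Has p φ c ↔ φ.Realize (Sum.elim c b) := by
  refine ⟨h k φ c hc, fun hφ => ?_⟩
  by_contra hn
  exact h k φ.not c hc ((p.has_not_iff φ c).2 hn) hφ

theorem IsInvariantMorleySequence.eq_coord_iff {β : Type x} {M : Set 𝕄} {s : ℕ → β → 𝕄}
    (hs : IsInvariantMorleySequence L M s) {m : 𝕄} (hm : m ∈ M) (i j : ℕ) (l : β) :
    m = s i l ↔ m = s j l := by
  obtain ⟨p, -, hp⟩ := hs
  have h : ∀ i, GlobalType.Has p (eqCoordFormula l) (fun _ => m) ↔ m = s i l := fun i =>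
    ((hp i).has_iff _ fun _ => Or.inl hm).trans (realize_eqCoordFormula l _ _)
  rw [← h i, ← h j]

/-- The added conjunct says that `χ` has fewer than `N` solutions in `y`, so the bound survives
every change of parameters. -/
theorem exists_bounded_formula {α : Type x} (χ : L.Formula (α ⊕ Fin 1)) (N : ℕ) :
    ∃ χ' : L.Formula (α ⊕ Fin 1), ∀ (v : α → 𝕄) (y : Fin 1 → 𝕄),
      χ'.Realize (Sum.elim v y) ↔ χ.Realize (Sum.elim v y) ∧
        ∀ e : Fin N → 𝕄, (∀ i, χ.Realize (Sum.elim v fun _ => e i)) →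
          ¬ Function.Injective e := by
  let ζ : L.Formula (α ⊕ Fin N) :=
    (Formula.iInf fun i : Fin N => χ.relabel (Sum.map id fun _ => i)).imp
      (Formula.iSup fun q : {q : Fin N × Fin N // q.1 ≠ q.2} =>
        Term.equal (Term.var (Sum.inr q.1.1)) (Term.var (Sum.inr q.1.2)))
  refine ⟨χ ⊓ (ζ.iAlls (Fin N)).relabel Sum.inl, fun v y => ?_⟩
  rw [Formula.realize_inf, Formula.realize_relabel, Formula.realize_iAlls]
  refine and_congr_right fun _ => forall_congr' fun e => ?_
  simp only [ζ, Formula.realize_imp, Formula.realize_iInf, Formula.realize_iSup,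
    Formula.realize_relabel, Formula.realize_equal, Term.realize_var]
  refine imp_congr (forall_congr' fun i => ?_) ?_
  · convert Iff.rfl using 2
    funext j
    rcases j with j | j <;> rfl
  · simp [Function.Injective, and_comm]

theorem exists_formula_of_definable₁ {C S : Set 𝕄} (hS : C.Definable₁ L S) :
    ∃ (k : ℕ) (c : Fin k → 𝕄) (θ : L.Formula (Fin k ⊕ Fin 1)), (∀ i, c i ∈ C) ∧
      ∀ y : Fin 1 → 𝕄, θ.Realize (Sum.elim c y) ↔ y 0 ∈ S := by
  obtain ⟨F, hF, hd⟩ := Set.definable_iff_finitely_definable.1 hS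
  obtain ⟨φ, hφ⟩ := Set.definable_iff_exists_formula_sum.1 hd
  let g : ↥(F : Set 𝕄) ≃ Fin F.card := F.equivFin
  refine ⟨F.card, fun i => g.symm i, φ.relabel (Sum.map g id), fun i => hF (g.symm i).2,
    fun y => ?_⟩
  rw [Formula.realize_relabel]
  refine Iff.trans ?_ (Set.ext_iff.1 hφ y).symm
  change _ ↔ φ.Realize _
  convert Iff.rfl using 2
  funext j
  rcases j with j | j
  · simp
  · rfl

/-- Algebraicity over `A ∪ M` is witnessed by a formula bounded uniformly in the parameters
from `A`. -/
theorem exists_bounded_formula_of_mem_acl_union {A M : Set 𝕄} (hM : M.Nonempty) {e : 𝕄}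
    (he : e ∈ acl L (A ∪ M)) :
    ∃ (n k N : ℕ) (a : Fin n → 𝕄) (m : Fin k → 𝕄) (χ : L.Formula ((Fin n ⊕ Fin k) ⊕ Fin 1)),
      (∀ i, a i ∈ A) ∧ (∀ i, m i ∈ M) ∧ χ.Realize (Sum.elim (Sum.elim a m) fun _ => e) ∧
      ∀ (a' : Fin n → 𝕄) (f : Fin N → 𝕄),
        (∀ i, χ.Realize (Sum.elim (Sum.elim a' m) fun _ => f i)) → ¬ Function.Injective f := by
  classical
  obtain ⟨S, hS, hf, heS⟩ := he
  obtain ⟨k, c, θ, hc, hθ⟩ := exists_formula_of_definable₁ hS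
  obtain ⟨m₀, hm₀⟩ := hM
  let g := (Fintype.equivFin {i // c i ∈ A})
  let a : Fin (Fintype.card {i // c i ∈ A}) → 𝕄 := fun i => c (g.symm i)
  -- The slots already served by `a` get the dummy value `m₀`, which keeps all of `m` in `M`; `r`
  -- never reads them.
  let m : Fin k → 𝕄 := fun i => if c i ∈ A then m₀ else c i
  let r : Fin k → Fin (Fintype.card {i // c i ∈ A}) ⊕ Fin k := fun i =>
    if h : c i ∈ A then Sum.inl (g ⟨i, h⟩) else Sum.inr i
  have hr : ∀ y : Fin 1 → 𝕄, Sum.elim (Sum.elim a m) y ∘ Sum.map r id = Sum.elim c y := by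
    intro y
    funext i
    rcases i with i | i
    · by_cases h : c i ∈ A <;> simp [r, a, m, h]
    · rfl
  have hcount : ∀ f : Fin (hf.toFinset.card + 1) → 𝕄,
      (∀ i, θ.Realize (Sum.elim c fun _ => f i)) → ¬ Function.Injective f := by
    intro f hfS hinj
    have := Finset.card_le_card_of_injOn (s := Finset.univ) (t := hf.toFinset) f
      (fun i _ => by simpa using (hθ _).1 (hfS i)) hinj.injOn
    simp at this
  obtain ⟨χ, hχ⟩ := exists_bounded_formula (𝕄 := 𝕄) (θ.relabel (Sum.map r id))
    (hf.toFinset.card + 1)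
  refine ⟨_, k, hf.toFinset.card + 1, a, m, χ, fun i => (g.symm i).2, fun i => ?_, ?_, ?_⟩
  · by_cases h : c i ∈ A
    · simpa [m, h] using hm₀
    · simpa [m, h] using (hc i).resolve_left h
  · rw [hχ]
    simp only [Formula.realize_relabel, hr]
    exact ⟨(hθ _).2 heS, hcount⟩
  · intro a' f h hinj
    simp only [hχ] at h
    exact (h 0).2 f (fun i => (h i).1) hinj

variable [Nonempty 𝕄]

/-- A repetition would put `y_l = s j l` into the global type; by invariance the same holds for
every conjugate of `s j l` over `M`. Hence that element has no other conjugate and lies in `acl L M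
= M`, whereas this coordinate never enters `M`. -/
theorem IsInvariantMorleySequence.injective_coord {κ : Cardinal.{w}} (h𝕄 : IsMonster L 𝕄 κ)
    {β : Type x} [Finite β] {M : Set 𝕄} (hM : Cardinal.mk M < κ) (hMc : acl L M = M)
    {s : ℕ → β → 𝕄} (hs : IsInvariantMorleySequence L M s) {l : β} (hl : s 0 l ∉ M) :
    Function.Injective fun i => s i l := by
  have hlt : ∀ j i, j < i → s i l ≠ s j l := by
    intro j i hji heq
    have hj : s j l ∉ acl L M := by
      rw [hMc]
      intro hj
      exact hl ((hs.eq_coord_iff hj 0 j l).2 rfl ▸ hj)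
    obtain ⟨p, hinv, hp⟩ := hs
    have hmem : s j l ∈ M ∪ ⋃ j < i, Set.range (s j) :=
      Or.inr (Set.mem_iUnion₂.2 ⟨j, hji, l, rfl⟩)
    have hhas : GlobalType.Has p (eqCoordFormula l) (fun _ => s j l) :=
      ((hp i).has_iff _ fun _ => hmem).2 ((realize_eqCoordFormula l _ _).2 heq.symm)
    refine hj (h𝕄.mem_acl_of_orbit_subset hM (Set.finite_singleton (s j l)) fun σ hσ => ?_)
    have hhas' := (hinv 1 (eqCoordFormula l) _ _
      (sameTypeOver_comp_aut σ hσ fun _ : Fin 1 => s j l)).1 hhas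
    obtain ⟨a, h1, h2⟩ := p.exists_realize hhas hhas'
    rw [realize_eqCoordFormula] at h1 h2
    exact h2.trans h1.symm
  intro i j hij
  rcases lt_trichotomy i j with h | h | h
  · exact absurd hij.symm (hlt i j h)
  · exact h
  · exact absurd hij (hlt j i h)

/-- A formula which is algebraic in a single parameter outside `M`, all its other parameters being
in `M`, Conant-divides over `M`. -/
theorem conantDivides_of_bounded {κ : Cardinal.{w}} (h𝕄 : IsMonster L 𝕄 κ) {M : Set 𝕄}
    (hM : Cardinal.mk M < κ) (hMc : acl L M = M) {n m : ℕ} {ψ : L.Formula (Fin n ⊕ Fin m)}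
    {d : Fin m → 𝕄} {l : Fin m} (hl : d l ∉ M) (hd : ∀ l', l' ≠ l → d l' ∈ M) (N : ℕ)
    (hN : ∀ (a : Fin n → 𝕄) (e : Fin N → 𝕄),
      (∀ i, ψ.Realize (Sum.elim a (Function.update d l (e i)))) → ¬ Function.Injective e) :
    ConantDivides M ψ d := by
  rintro s hs rfl
  refine ⟨Finset.range N, ?_⟩
  rintro ⟨a, ha⟩
  refine hN a (fun i => s i l) (fun i => ?_)
    ((hs.injective_coord h𝕄 hM hMc hl).comp Fin.val_injective)
  have : Function.update (s 0) l (s i l) = s i := by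
    funext l'
    by_cases h : l' = l
    · subst h
      simp
    · rw [Function.update_of_ne h]
      exact (hs.eq_coord_iff (hd l' h) 0 i l').1 rfl
  rw [this]
  exact ha i (Finset.mem_range.2 i.2)

/-- A common algebraic element outside `M` produces an explicit Conant-forking formula: some `y` in
a finite set avoiding `M` satisfies `χ(x, m, y)`. -/
theorem inter_subset_of_conantIndependent {κ : Cardinal.{w}} (h𝕄 : IsMonster L 𝕄 κ)
    {M A B : Set 𝕄} (hM : Cardinal.mk M < κ) (hMc : acl L M = M) (hMne : M.Nonempty)
    (h : ConantIndependent L M A B) : acl L (A ∪ M) ∩ acl L (B ∪ M) ⊆ M := by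
  rintro e ⟨heA, S, hS, hSf, heS⟩
  by_contra heM
  obtain ⟨n, k, N, a, m, χ, ha, hm, hχe, hχ⟩ := exists_bounded_formula_of_mem_acl_union hMne heA
  -- Removing the finitely many points in `M` costs no definability and makes every disjunct's
  -- parameter non-algebraic over `M`.
  have hS' : (B ∪ M).Definable₁ L (S \ (S ∩ M)) :=
    Set.Definable.sdiff hS (definable₁_of_finite (L := L) (hSf.subset Set.inter_subset_left)
      (Set.inter_subset_right.trans Set.subset_union_right))
  obtain ⟨k', c, θ, hc, hθ⟩ := exists_formula_of_definable₁ hS'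
  obtain ⟨q, f, -, hf⟩ := (hSf.subset (Set.sdiff_subset : S \ (S ∩ M) ⊆ S)).fin_param
  have hfM : ∀ j, f j ∉ M := fun j hj => by
    have : f j ∈ S \ (S ∩ M) := hf ▸ ⟨j, rfl⟩
    exact this.2 ⟨this.1, hj⟩
  let r : (Fin n ⊕ Fin k) ⊕ Fin 1 → Fin n ⊕ Fin (k + 1) :=
    Sum.elim (Sum.map id fun i => finSumFinEquiv (Sum.inl i))
      fun i => Sum.inr (finSumFinEquiv (Sum.inr i))
  -- `d z` is the tuple `(m, z)`: only its last entry can leave `M`, as `conantDivides_of_bounded`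
  -- requires.
  let d : 𝕄 → Fin (k + 1) → 𝕄 := fun z => Sum.elim m (fun _ => z) ∘ finSumFinEquiv.symm
  have hr : ∀ (a' : Fin n → 𝕄) (z : 𝕄), Sum.elim a' (d z) ∘ r
      = Sum.elim (Sum.elim a' m) fun _ => z := by
    intro a' z
    funext i
    rcases i with (i | i) | i <;>
      simp [r, d, -finSumFinEquiv_apply_left, -finSumFinEquiv_apply_right]
  have hupd : ∀ z z', Function.update (d z) (finSumFinEquiv (Sum.inr 0)) z' = d z' := by
    intro z z'
    funext i
    obtain ⟨i, rfl⟩ := finSumFinEquiv.surjective i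
    rcases i with i | i
    · rw [Function.update_of_ne (by simp [-finSumFinEquiv_apply_left, -finSumFinEquiv_apply_right])]
      simp [d, -finSumFinEquiv_apply_left]
    · rw [Subsingleton.elim i 0]
      simp [d, -finSumFinEquiv_apply_right]
  let θ' : L.Formula ((Fin n ⊕ Fin (k' + k)) ⊕ Fin 1) :=
    θ.relabel (Sum.map (fun i => Sum.inr (finSumFinEquiv (Sum.inl i))) id)
  let χ' : L.Formula ((Fin n ⊕ Fin (k' + k)) ⊕ Fin 1) :=
    χ.relabel (Sum.map (Sum.map id fun i => finSumFinEquiv (Sum.inr i)) id)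
  let c' : Fin (k' + k) → 𝕄 := Sum.elim c m ∘ finSumFinEquiv.symm
  have hθ' : ∀ (a' : Fin n → 𝕄) (y : Fin 1 → 𝕄),
      θ'.Realize (Sum.elim (Sum.elim a' c') y) ↔ y 0 ∈ S \ (S ∩ M) := by
    intro a' y
    rw [← hθ y, Formula.realize_relabel]
    convert Iff.rfl using 2
    funext i
    rcases i with i | i <;> simp [c', -finSumFinEquiv_apply_left]
  have hχ' : ∀ (a' : Fin n → 𝕄) (y : Fin 1 → 𝕄),
      χ'.Realize (Sum.elim (Sum.elim a' c') y) ↔ χ.Realize (Sum.elim (Sum.elim a' m) y) := by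
    intro a' y
    rw [Formula.realize_relabel]
    convert Iff.rfl using 2
    funext i
    rcases i with (i | i) | i <;> simp [c', -finSumFinEquiv_apply_right]
  have hφ : ∀ a' : Fin n → 𝕄, ((θ' ⊓ χ').iExs (Fin 1)).Realize (Sum.elim a' c') ↔
      ∃ y : Fin 1 → 𝕄, y 0 ∈ S \ (S ∩ M) ∧ χ.Realize (Sum.elim (Sum.elim a' m) y) := by
    intro a'
    rw [Formula.realize_iExs]
    exact exists_congr fun y => by rw [Formula.realize_inf, hθ', hχ']
  refine h n (k' + k) ((θ' ⊓ χ').iExs (Fin 1)) a c' ha (fun j => ?_)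
    ((hφ a).2 ⟨fun _ => e, ⟨heS, fun h => heM h.2⟩, hχe⟩)
    ⟨q, fun _ => k + 1, fun _ => χ.relabel r, fun j => d (f j), fun j => ?_, fun a' ha' => ?_⟩
  · obtain ⟨j, rfl⟩ := finSumFinEquiv.surjective j
    rcases j with j | j
    · simpa [c', -finSumFinEquiv_apply_left] using (hc j).symm
    · simpa [c', -finSumFinEquiv_apply_right] using Or.inl (hm j)
  · refine conantDivides_of_bounded h𝕄 hM hMc (l := finSumFinEquiv (Sum.inr 0)) ?_ ?_ N ?_
    · simpa [d, -finSumFinEquiv_apply_right] using hfM j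
    · intro l' hl'
      obtain ⟨i, rfl⟩ := finSumFinEquiv.surjective l'
      rcases i with i | i
      · simpa [d, -finSumFinEquiv_apply_left] using hm i
      · exact absurd (by rw [Subsingleton.elim i 0]) hl'
    · intro a' z hz
      refine hχ a' z fun i => ?_
      have := hz i
      rwa [hupd, Formula.realize_relabel, hr] at this
  · obtain ⟨y, hyS, hy⟩ := (hφ a').1 ha'
    rw [← hf] at hyS
    obtain ⟨j, hj⟩ := hyS
    refine ⟨j, ?_⟩
    rw [Formula.realize_relabel, hr]
    have : (fun _ => f j) = y := funext fun i => by rw [hj, Subsingleton.elim i 0]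
    rwa [this]

end ConantDividing

end ConantIndep

theorem mainTheorem9 {L : FirstOrder.Language.{u, v}} (T : L.Theory)
    (𝕄 : Type w) [L.Structure 𝕄] [Nonempty 𝕄] (κ : Cardinal.{w})
    (hT : ConantIndep.IsFreeAmalgamationTheory L T 𝕄 κ)
    (M : L.ElementarySubstructure 𝕄) (hM : Cardinal.mk M < κ)
    (A B : Set 𝕄) (hA : Cardinal.mk A < κ) (hB : Cardinal.mk B < κ) :
    ConantIndep.ConantIndependent L (M : Set 𝕄) A B ↔
      ConantIndep.AlgIndependent L (M : Set 𝕄) A B := by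
  have h𝕄 := hT.monster
  obtain ⟨R, hR⟩ := hT.exists_relation
  have hMc := ConantIndep.acl_elementarySubstructure M
  constructor
  · intro h
    refine Set.Subset.antisymm (ConantIndep.inter_subset_of_conantIndependent h𝕄 hM hMc
      (Set.nonempty_coe_sort.1 ElementarySubstructure.instNonempty) h) ?_
    exact Set.subset_inter (Set.subset_union_right.trans (ConantIndep.subset_acl _))
      (Set.subset_union_right.trans (ConantIndep.subset_acl _))
  · intro h
    exact hR.conantIndependent_of_inter_subset h𝕄 hM hMc hA hB h.subset
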